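/- **Theorem 1.1.** Let $p,q,m,n$ be integers with $|p|,|q|\ge 2$, $|p|+1<m<2|p|-1$ and $n\ge (|q|+1)/2$, and let $a\in\mathbb{R}$. Let $$A=\begin{pmatrix} p & 0\\ -a & q\end{pmatrix},\qquad \mathcal D=\left\{\binom{i}{j} : i\in\{0,1,\dots,m-1\},\ j\in\{0,1,\dots,n-1\}\right\},$$ and let $$T(A,\mathcal D)=\Big\{\sum_{k\ge 1}A^{-k}d_k : d_k\in\mathcal D \text{ for all } k\ge 1\Big\}\subset\mathbb{R}^2$$ be the self-affine set generated by $(A,\mathcal D)$, that is, the unique nonempty compact set $T$ with $T=\bigcup_{d\in\mathcal D}A^{-1}(T+d)$. (i) If $|q|=2$, then $T(A,\mathcal D)$ is connected (for every $a$). (ii) If $|q|\ge 3$, then $T(A,\mathcal D)$ is connected if and only if $$|q|(|q|-n)\le |a|\le \frac{q^2(n-1)}{|q|-2}\qquad\text{or}\qquad |q|-n\le |a|\le \frac{|q|(n-1)}{|q|-2}.$$ -/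

import Mathlib

open scoped Matrix

/-- The self-affine set `T(A, D) = { ∑_{i ≥ 1} A⁻ⁱ dᵢ : dᵢ ∈ D }` of radix expansions generated by
a real square matrix `A` and a digit set `D`. The index `k : ℕ` stands for `i = k + 1`, and
`HasSum` says that the series converges to `x`. -/
def selfAffineSet {d : ℕ} (A : Matrix (Fin d) (Fin d) ℝ) (D : Set (Fin d → ℝ)) :
    Set (Fin d → ℝ) :=
  {x | ∃ δ : ℕ → (Fin d → ℝ), (∀ k, δ k ∈ D) ∧ HasSum (fun k => (A⁻¹ ^ (k + 1)) *ᵥ δ k) x}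

/-- The lower triangular matrix with rows `(p, 0)` and `(-a, q)`. -/
def lowerTriangular (p q : ℤ) (a : ℝ) : Matrix (Fin 2) (Fin 2) ℝ :=
  !![(p : ℝ), 0; -a, (q : ℝ)]

/-- The product digit set `{0, …, m - 1} × {0, …, n - 1}` in the plane. -/
def productDigits (m n : ℕ) : Set (Fin 2 → ℝ) :=
  {v | ∃ i j : ℕ, i < m ∧ j < n ∧ v = ![(i : ℝ), (j : ℝ)]}

/-!
Write `T` for the self-affine set and `Q = |q|`. By Hata's criterion
(`isPreconnected_range_coding_iff`), `T` is connected iff the graph on the digits is connected in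
which `d` and `d'` are joined when the pieces `A⁻¹(T + d)` and `A⁻¹(T + d')` meet. They meet iff
`d - d' ∈ T - T`, which holds iff `d - d'` starts a bounded orbit of the expanding map `A`,
perturbed at each step by a difference of digits (`exists_radixPoint_prepend_eq_iff`).

For such an orbit starting at an integer point, the first coordinates are integers of size at most
`(m - 1) / (|p| - 1) < 2`, so they lie in `{-1, 0, 1}`; since `m - 1 ≥ |p| + 1`, every sequence in
`{-1, 0, 1}` occurs. Since `2 n - 1 ≥ Q`, the digits `|j| ≤ n - 1` of the second coordinate fill
the interval of radius `(n - 1) / (Q - 1)`. Hence `(u, v)` is a difference along an edge iff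
`u ∈ {-1, 0, 1}` and `v` is within `(n - 1) / (Q - 1)` of a drift `(a / q) (u + c)`, where `c` runs
over the sums `∑ q⁻ᵏ r_k` with `r_k ∈ {-1, 0, 1}`, of size at most `1 / (Q - 1)`.

The necessary half of this is `IsOverlap.bounds`; for the sufficient half (`IsDrift.isOverlap`) only
the extreme values of `c` and one more are needed. The graph can be connected in two ways: by
vertical edges `(0, 1)` together with some edge `(1, v)`, or, without vertical edges, by edges
`(1, 0)` and `(1, 1)` (or `(1, -1)`, according to the sign of `a / q`). They give the two ranges of
`|a|`. Outside both ranges, the columns or the rows are separated from each other, or all edges are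
diagonal in the same direction, which isolates a corner of the digit rectangle.
-/

/-! ### Connectedness of a set coded by sequences -/

/-- The sequence over an alphabet with first letter `d`, followed by `ω`. -/
def prepend {ι : Type*} (d : ι) (ω : ℕ → ι) : ℕ → ι
  | 0 => d
  | k + 1 => ω k

theorem prepend_head_tail {ι : Type*} (ω : ℕ → ι) : prepend (ω 0) (fun k => ω (k + 1)) = ω := by
  funext k
  cases k <;> rfl

theorem continuous_prepend {ι : Type*} [TopologicalSpace ι] (d : ι) :
    Continuous (prepend d : (ℕ → ι) → ℕ → ι) := by
  refine continuous_pi fun k => ?_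
  cases k with
  | zero => exact continuous_const
  | succ k => exact continuous_apply k

/-- By compactness, membership in a clopen set of sequences over a finite alphabet is decided by an
initial segment of fixed length. -/
theorem IsClopen.exists_initial_segment {ι : Type*} [Finite ι] [TopologicalSpace ι]
    [DiscreteTopology ι] {S : Set (ℕ → ι)} (hS : IsClopen S) :
    ∃ n, ∀ ω ω' : ℕ → ι, (∀ k < n, ω k = ω' k) → (ω ∈ S ↔ ω' ∈ S) := by
  have key : ∀ O : Set (ℕ → ι), IsOpen O → ∀ ω ∈ O, ∃ n, ∀ ω' : ℕ → ι,
      (∀ k < n, ω' k = ω k) → ω' ∈ O := by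
    intro O hO ω hω
    obtain ⟨I, u, hu, hsub⟩ := isOpen_pi_iff.1 hO ω hω
    refine ⟨I.sup id + 1, fun ω' h => hsub fun i hi => ?_⟩
    rw [h i (Nat.lt_succ_of_le (Finset.le_sup (f := id) hi))]
    exact (hu i hi).2
  have hloc : ∀ ω : ℕ → ι, ∃ n, ∀ ω' : ℕ → ι, (∀ k < n, ω' k = ω k) → (ω' ∈ S ↔ ω ∈ S) := by
    intro ω
    by_cases hω : ω ∈ S
    · obtain ⟨n, hn⟩ := key S hS.isOpen ω hω
      exact ⟨n, fun ω' h => iff_of_true (hn ω' h) hω⟩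
    · obtain ⟨n, hn⟩ := key Sᶜ hS.compl.isOpen ω hω
      exact ⟨n, fun ω' h => iff_of_false (hn ω' h) hω⟩
  choose N hN using hloc
  obtain ⟨t, ht⟩ := CompactSpace.elim_nhds_subcover (fun ω => {ω' | ∀ k < N ω, ω' k = ω k})
    (fun ω => by
      have : {ω' : ℕ → ι | ∀ k < N ω, ω' k = ω k} = (Set.Iio (N ω)).pi fun k => {ω k} := by
        ext; simp [Set.mem_pi]
      rw [this]
      exact set_pi_mem_nhds (Set.finite_Iio _) fun k _ => by simp)
  refine ⟨t.sup N, fun ω ω' h => ?_⟩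
  have hmem : ω ∈ ⋃ x ∈ t, {ω' | ∀ k < N x, ω' k = x k} := ht ▸ Set.mem_univ _
  simp only [Set.mem_iUnion] at hmem
  obtain ⟨x, hx, hωx⟩ := hmem
  rw [hN x ω hωx, hN x ω' fun k hk => by
    rw [← h k (hk.trans_le (Finset.le_sup hx)), hωx k hk]]

/-- Hata's criterion. Let `E` carry a self-similar set coded by sequences over a finite alphabet:
`π` maps a sequence to a point, and prepending the letter `d` acts as the map `φ d`. The set is
preconnected iff the graph on the alphabet joining letters whose first-level pieces meet is
connected, which is expressed here by saying that only the constant predicates on the alphabet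
respect the edges. -/
theorem isPreconnected_range_coding_iff {ι E : Type*} [Finite ι] [TopologicalSpace ι]
    [DiscreteTopology ι] [TopologicalSpace E] [T2Space E] {π : (ℕ → ι) → E} (hπ : Continuous π)
    {φ : ι → E → E} (hφ : ∀ d ω, π (prepend d ω) = φ d (π ω)) :
    IsPreconnected (Set.range π) ↔
      ∀ h : ι → Prop,
        (∀ d d', (∃ ω ω', π (prepend d ω) = π (prepend d' ω')) → (h d ↔ h d')) →
          ∀ d d', h d ↔ h d' := by
  constructor
  · intro hconn h hh
    by_contra! hne
    obtain ⟨d₁, d₂, h₁, h₂⟩ : ∃ d₁ d₂, h d₁ ∧ ¬ h d₂ := by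
      obtain ⟨d, d', h1 | h1⟩ := hne
      exacts [⟨d, d', h1⟩, ⟨d', d, h1.symm⟩]
    let F : (ι → Prop) → Set E := fun P => ⋃ d ∈ {d | P d}, Set.range fun ω => π (prepend d ω)
    have hF : ∀ P, IsClosed (F P) := fun P =>
      (Set.toFinite _).isClosed_biUnion fun d _ =>
        (isCompact_range (hπ.comp (continuous_prepend d))).isClosed
    have hmem : ∀ (P : ι → Prop) d ω, P d → π (prepend d ω) ∈ F P := fun P d ω hd =>
      Set.mem_biUnion (show d ∈ {d | P d} from hd) ⟨ω, rfl⟩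
    obtain ⟨x, -, hx, hx'⟩ := isPreconnected_closed_iff.1 hconn (F h) (F fun d => ¬ h d) (hF _)
      (hF _)
      (by
        rintro _ ⟨ω, rfl⟩
        rw [← prepend_head_tail ω]
        by_cases hω : h (ω 0)
        · exact Or.inl (hmem h _ _ hω)
        · exact Or.inr (hmem (fun d => ¬ h d) _ _ hω))
      ⟨_, ⟨_, rfl⟩, hmem h d₁ (fun _ => d₁) h₁⟩
      ⟨_, ⟨_, rfl⟩, hmem (fun d => ¬ h d) d₂ (fun _ => d₁) h₂⟩
    simp only [F, Set.mem_iUnion] at hx hx'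
    obtain ⟨d, hd, ω, rfl⟩ := hx
    obtain ⟨d', hd', ω', h'⟩ := hx'
    exact hd' ((hh d d' ⟨ω, ω', h'.symm⟩).1 hd)
  · intro H
    -- A predicate on `E` read off from the first `n` letters is constant, by induction on `n`.
    have key : ∀ n, ∀ g : E → Prop,
        (∀ ω ω', (∀ k < n, ω k = ω' k) → (g (π ω) ↔ g (π ω'))) → ∀ ω ω', g (π ω) ↔ g (π ω') := by
      intro n
      induction n with
      | zero => exact fun g hg ω ω' => hg ω ω' (by simp)
      | succ n ih =>
        intro g hg
        have hd : ∀ d ω ω', g (π (prepend d ω)) ↔ g (π (prepend d ω')) := by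
          intro d
          simp only [hφ]
          refine ih (fun x => g (φ d x)) fun ω ω' h => ?_
          simp only [← hφ]
          refine hg _ _ fun k hk => ?_
          cases k with
          | zero => rfl
          | succ k => exact h k (by omega)
        intro ω ω'
        have hc := H (fun d => g (π (prepend d ω))) (by
          rintro d d' ⟨η, η', h⟩
          rw [hd d ω η, h, hd d' η' ω]) (ω 0) (ω' 0)
        rw [← prepend_head_tail ω, ← prepend_head_tail ω']
        rw [hd _ _ ω, hc, hd]
    rintro u v hu hv huv ⟨_, ⟨ω, rfl⟩, hω⟩ ⟨_, ⟨ω', rfl⟩, hω'⟩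
    by_contra hdis
    have hcompl : (π ⁻¹' u)ᶜ = π ⁻¹' v := by
      ext η
      have h1 : π η ∈ u ∨ π η ∈ v := huv ⟨η, rfl⟩
      have h2 : ¬ (π η ∈ u ∧ π η ∈ v) := fun h => hdis ⟨_, ⟨η, rfl⟩, h⟩
      simp only [Set.mem_compl_iff, Set.mem_preimage]
      tauto
    have hclopen : IsClopen (π ⁻¹' u) :=
      ⟨isOpen_compl_iff.1 (hcompl ▸ hv.preimage hπ), hu.preimage hπ⟩
    obtain ⟨n, hn⟩ := hclopen.exists_initial_segment
    exact hdis ⟨_, ⟨ω', rfl⟩, (key n (· ∈ u) hn ω ω').1 hω, hω'⟩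

/-! ### Radix expansions and overlaps of first-level pieces -/

theorem inv_lowerTriangular {p q : ℤ} (hp : p ≠ 0) (hq : q ≠ 0) (a : ℝ) :
    (lowerTriangular p q a)⁻¹ = !![(p : ℝ)⁻¹, 0; a / (p * q), (q : ℝ)⁻¹] := by
  have hp' : (p : ℝ) ≠ 0 := by exact_mod_cast hp
  have hq' : (q : ℝ) ≠ 0 := by exact_mod_cast hq
  refine Matrix.inv_eq_right_inv ?_
  ext i j
  fin_cases i <;> fin_cases j <;> simp [lowerTriangular, Matrix.mul_apply, Fin.sum_univ_two, hp', hq']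
  field_simp
  ring

theorem inv_mul_lowerTriangular {p q : ℤ} (hp : p ≠ 0) (hq : q ≠ 0) (a : ℝ) :
    (lowerTriangular p q a)⁻¹ * lowerTriangular p q a = 1 := by
  refine Matrix.nonsing_inv_mul _ (isUnit_iff_ne_zero.2 ?_)
  simp [lowerTriangular, Matrix.det_fin_two, hp, hq]

theorem mul_inv_lowerTriangular {p q : ℤ} (hp : p ≠ 0) (hq : q ≠ 0) (a : ℝ) :
    lowerTriangular p q a * (lowerTriangular p q a)⁻¹ = 1 := by
  refine Matrix.mul_nonsing_inv _ (isUnit_iff_ne_zero.2 ?_)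
  simp [lowerTriangular, Matrix.det_fin_two, hp, hq]

theorem two_le_abs_cast {p : ℤ} (hp : 2 ≤ |p|) : (2 : ℝ) ≤ |(p : ℝ)| := by
  exact_mod_cast hp

theorem ne_zero_of_two_le_abs {p : ℤ} (hp : 2 ≤ |p|) : p ≠ 0 := by
  rintro rfl
  simp at hp

/-- The powers of `A⁻¹` decay geometrically. The rate `3 / 4` leaves room, above the eigenvalues
of size at most `1 / 2`, for the linear factor produced by a Jordan block. -/
theorem norm_inv_lowerTriangular_pow_mulVec_le {p q : ℤ} (hp : 2 ≤ |p|) (hq : 2 ≤ |q|) (a : ℝ)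
    (k : ℕ) (v : Fin 2 → ℝ) :
    ‖((lowerTriangular p q a)⁻¹ ^ k) *ᵥ v‖ ≤ (1 + |a|) * ‖v‖ * (3 / 4) ^ k := by
  have hp2 := two_le_abs_cast hp
  have hq2 := two_le_abs_cast hq
  set B := (lowerTriangular p q a)⁻¹ with hB
  have hBe := inv_lowerTriangular (ne_zero_of_two_le_abs hp) (ne_zero_of_two_le_abs hq) a
  rw [← hB] at hBe
  have hv0 : |v 0| ≤ ‖v‖ := norm_le_pi_norm v 0
  have hv1 : |v 1| ≤ ‖v‖ := norm_le_pi_norm v 1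
  have hpi : |(p : ℝ)|⁻¹ ≤ 2⁻¹ := inv_anti₀ (by norm_num) hp2
  have hqi : |(q : ℝ)|⁻¹ ≤ 2⁻¹ := inv_anti₀ (by norm_num) hq2
  have ha := abs_nonneg a
  have hvn := norm_nonneg v
  have key : |(B ^ k *ᵥ v) 0| ≤ ‖v‖ * (1 / 2) ^ k ∧
      |(B ^ k *ᵥ v) 1| ≤ (1 + |a|) * ‖v‖ * (3 / 4) ^ k := by
    induction k with
    | zero =>
      simp only [pow_zero, Matrix.one_mulVec, mul_one]
      exact ⟨hv0, hv1.trans (by nlinarith)⟩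
    | succ k ih =>
      obtain ⟨h0, h1⟩ := ih
      rw [pow_succ', ← Matrix.mulVec_mulVec]
      set w := B ^ k *ᵥ v
      have e0 : (B *ᵥ w) 0 = (p : ℝ)⁻¹ * w 0 := by
        simp [hBe, Matrix.mulVec, dotProduct, Fin.sum_univ_two]
      have e1 : (B *ᵥ w) 1 = a * ((p : ℝ)⁻¹ * (q : ℝ)⁻¹) * w 0 + (q : ℝ)⁻¹ * w 1 := by
        rw [← mul_inv, ← div_eq_mul_inv]
        simp [hBe, Matrix.mulVec, dotProduct, Fin.sum_univ_two]
      have hpq : |(p : ℝ)|⁻¹ * |(q : ℝ)|⁻¹ ≤ 2⁻¹ * 2⁻¹ := by gcongr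
      have hpow : ((1 : ℝ) / 2) ^ k ≤ (3 / 4) ^ k :=
        pow_le_pow_left₀ (by norm_num) (by norm_num) k
      constructor
      · rw [e0, abs_mul, abs_inv, pow_succ]
        calc |(p : ℝ)|⁻¹ * |w 0| ≤ 2⁻¹ * (‖v‖ * (1 / 2) ^ k) := by gcongr
          _ = _ := by ring
      · rw [e1]
        calc |a * ((p : ℝ)⁻¹ * (q : ℝ)⁻¹) * w 0 + (q : ℝ)⁻¹ * w 1|
            ≤ |a * ((p : ℝ)⁻¹ * (q : ℝ)⁻¹) * w 0| + |(q : ℝ)⁻¹ * w 1| := abs_add_le _ _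
          _ = |a| * (|(p : ℝ)|⁻¹ * |(q : ℝ)|⁻¹) * |w 0| + |(q : ℝ)|⁻¹ * |w 1| := by
              simp only [abs_mul, abs_inv]
          _ ≤ |a| * (2⁻¹ * 2⁻¹) * (‖v‖ * (3 / 4) ^ k) +
              2⁻¹ * ((1 + |a|) * ‖v‖ * (3 / 4) ^ k) := by
              gcongr
              exact h0.trans (by gcongr)
          _ ≤ _ := by
              rw [pow_succ]
              have : 0 ≤ ‖v‖ * (3 / 4) ^ k := by positivity
              nlinarith
  refine (pi_norm_le_iff_of_nonneg (by positivity)).2 fun i => ?_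
  fin_cases i
  · refine key.1.trans ?_
    calc ‖v‖ * (1 / 2) ^ k ≤ ‖v‖ * (3 / 4) ^ k :=
          mul_le_mul_of_nonneg_left (pow_le_pow_left₀ (by norm_num) (by norm_num) k) hvn
      _ ≤ _ := by
        have : 0 ≤ |a| * (‖v‖ * (3 / 4) ^ k) := by positivity
        nlinarith
  · exact key.2

/-- The digit vector `(i, j)`. -/
def digit {m n : ℕ} (d : Fin m × Fin n) : Fin 2 → ℝ := ![((d.1 : ℕ) : ℝ), ((d.2 : ℕ) : ℝ)]

theorem norm_digit_le {m n : ℕ} (d : Fin m × Fin n) : ‖digit d‖ ≤ m + n := by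
  refine (pi_norm_le_iff_of_nonneg (by positivity)).2 fun i => ?_
  have h1 : ((d.1 : ℕ) : ℝ) ≤ m := by exact_mod_cast d.1.2.le
  have h2 : ((d.2 : ℕ) : ℝ) ≤ n := by exact_mod_cast d.2.2.le
  have h3 : (0 : ℝ) ≤ m := by positivity
  have h4 : (0 : ℝ) ≤ n := by positivity
  fin_cases i <;> simp [digit] <;> linarith

/-- The point of the plane with radix expansion `ω` in base `A`. -/
noncomputable def radixPoint (p q : ℤ) (a : ℝ) {m n : ℕ} (ω : ℕ → Fin m × Fin n) : Fin 2 → ℝ :=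
  ∑' k, ((lowerTriangular p q a)⁻¹ ^ (k + 1)) *ᵥ digit (ω k)

theorem norm_radix_term_le {p q : ℤ} (hp : 2 ≤ |p|) (hq : 2 ≤ |q|) (a : ℝ) {m n : ℕ}
    (ω : ℕ → Fin m × Fin n) (k : ℕ) :
    ‖((lowerTriangular p q a)⁻¹ ^ (k + 1)) *ᵥ digit (ω k)‖ ≤
      (1 + |a|) * (m + n) * (3 / 4) ^ (k + 1) := by
  refine (norm_inv_lowerTriangular_pow_mulVec_le hp hq a _ _).trans ?_
  gcongr
  exact norm_digit_le _

theorem summable_radix_bound (c : ℝ) : Summable fun k : ℕ => c * (3 / 4 : ℝ) ^ (k + 1) :=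
  ((summable_nat_add_iff 1).2 (summable_geometric_of_lt_one (by norm_num) (by norm_num))).mul_left c

theorem summable_radix {p q : ℤ} (hp : 2 ≤ |p|) (hq : 2 ≤ |q|) (a : ℝ) {m n : ℕ}
    (ω : ℕ → Fin m × Fin n) :
    Summable fun k => ((lowerTriangular p q a)⁻¹ ^ (k + 1)) *ᵥ digit (ω k) :=
  .of_norm_bounded (summable_radix_bound _) (norm_radix_term_le hp hq a ω)

theorem continuous_radixPoint {p q : ℤ} (hp : 2 ≤ |p|) (hq : 2 ≤ |q|) (a : ℝ) (m n : ℕ) :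
    Continuous (radixPoint p q a : (ℕ → Fin m × Fin n) → Fin 2 → ℝ) := by
  refine continuous_tsum (fun k => ?_) (summable_radix_bound _)
    fun k ω => norm_radix_term_le hp hq a ω k
  exact (continuous_of_discreteTopology
    (f := fun d : Fin m × Fin n => ((lowerTriangular p q a)⁻¹ ^ (k + 1)) *ᵥ digit d)).comp
    (continuous_apply k)

theorem exists_norm_radixPoint_le {p q : ℤ} (hp : 2 ≤ |p|) (hq : 2 ≤ |q|) (a : ℝ) (m n : ℕ) :
    ∃ C, ∀ ω : ℕ → Fin m × Fin n, ‖radixPoint p q a ω‖ ≤ C := by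
  obtain ⟨C, hC⟩ := (isCompact_range (continuous_radixPoint hp hq a m n)).isBounded.exists_norm_le
  exact ⟨C, fun ω => hC _ ⟨ω, rfl⟩⟩

theorem radixPoint_prepend {p q : ℤ} (hp : 2 ≤ |p|) (hq : 2 ≤ |q|) (a : ℝ) {m n : ℕ}
    (d : Fin m × Fin n) (ω : ℕ → Fin m × Fin n) :
    radixPoint p q a (prepend d ω) =
      (lowerTriangular p q a)⁻¹ *ᵥ (digit d + radixPoint p q a ω) := by
  rw [radixPoint, (summable_radix hp hq a (prepend d ω)).tsum_eq_zero_add, Matrix.mulVec_add]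
  congr 1
  · simp [prepend]
  · have h := (summable_radix hp hq a ω).hasSum.map
      (Matrix.mulVecLin (lowerTriangular p q a)⁻¹)
      (LinearMap.continuous_of_finiteDimensional _)
    rw [← radixPoint] at h
    refine Eq.trans ?_ h.tsum_eq
    refine tsum_congr fun k => ?_
    simp only [prepend, pow_succ' _ (k + 1), Function.comp_apply, Matrix.mulVecLin_apply,
      Matrix.mulVec_mulVec]

theorem selfAffineSet_eq_range {p q : ℤ} (hp : 2 ≤ |p|) (hq : 2 ≤ |q|) (a : ℝ) (m n : ℕ) :
    selfAffineSet (lowerTriangular p q a) (productDigits m n) =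
      Set.range (radixPoint p q a : (ℕ → Fin m × Fin n) → Fin 2 → ℝ) := by
  ext x
  constructor
  · rintro ⟨δ, hδ, hx⟩
    have : ∀ k, ∃ d : Fin m × Fin n, digit d = δ k := by
      intro k
      obtain ⟨i, j, hi, hj, h⟩ := hδ k
      exact ⟨(⟨i, hi⟩, ⟨j, hj⟩), h.symm⟩
    choose ω hω using this
    refine ⟨ω, ?_⟩
    simp only [radixPoint, hω]
    exact hx.tsum_eq
  · rintro ⟨ω, rfl⟩
    exact ⟨fun k => digit (ω k), fun k => ⟨_, _, (ω k).1.2, (ω k).2.2, rfl⟩,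
      (summable_radix hp hq a ω).hasSum⟩

/-- A point of `T - T`, for `T` the self-affine set of `lowerTriangular p q a` and
`productDigits m n`, in terms of its orbit: `(u, v)` lies in `T - T` iff it starts a bounded
sequence `t` such that every `A t_k - t_{k+1}` is a difference `(i, j)` of digits. -/
def IsOverlap (p q : ℤ) (a : ℝ) (m n : ℕ) (u v : ℤ) : Prop :=
  ∃ x y : ℕ → ℝ, x 0 = u ∧ y 0 = v ∧ (∃ C, ∀ k, |x k| ≤ C ∧ |y k| ≤ C) ∧
    ∀ k, ∃ i j : ℤ, |i| < m ∧ |j| < n ∧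
      p * x k = x (k + 1) + i ∧ q * y k = a * x k + y (k + 1) + j

/-- A bounded orbit of the expanding map `A` vanishes. -/
theorem eq_zero_of_bounded_orbit {p q : ℤ} (hp : 2 ≤ |p|) (hq : 2 ≤ |q|) (a : ℝ)
    {s : ℕ → Fin 2 → ℝ} {C : ℝ} (hC : ∀ k, ‖s k‖ ≤ C)
    (hs : ∀ k, s k = (lowerTriangular p q a)⁻¹ *ᵥ s (k + 1)) : s 0 = 0 := by
  have h : ∀ k, s 0 = ((lowerTriangular p q a)⁻¹ ^ k) *ᵥ s k := by
    intro k
    induction k with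
    | zero => simp
    | succ k ih => rw [ih, hs k, Matrix.mulVec_mulVec, ← pow_succ]
  have hle : ∀ k : ℕ, ‖s 0‖ ≤ (1 + |a|) * C * (3 / 4) ^ k := by
    intro k
    rw [h k]
    refine (norm_inv_lowerTriangular_pow_mulVec_le hp hq a _ _).trans ?_
    gcongr
    exact hC k
  have hlim : Filter.Tendsto (fun k : ℕ => (1 + |a|) * C * (3 / 4 : ℝ) ^ k) Filter.atTop
      (nhds ((1 + |a|) * C * 0)) :=
    (tendsto_pow_atTop_nhds_zero_of_lt_one (by norm_num) (by norm_num)).const_mul _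
  have := ge_of_tendsto' hlim hle
  rw [mul_zero] at this
  exact norm_le_zero_iff.1 this

theorem exists_fin_sub_eq {m : ℕ} {i : ℤ} (h : |i| < m) :
    ∃ b c : Fin m, (((b : ℕ) : ℝ)) - ((c : ℕ) : ℝ) = i := by
  rw [abs_lt] at h
  rcases le_total 0 i with hi | hi
  · refine ⟨⟨i.toNat, by omega⟩, ⟨0, by omega⟩, ?_⟩
    have : ((i.toNat : ℤ) : ℝ) = i := by rw [Int.toNat_of_nonneg hi]
    rw [Int.cast_natCast] at this
    simp only [this, Nat.cast_zero, sub_zero]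
  · refine ⟨⟨0, by omega⟩, ⟨(-i).toNat, by omega⟩, ?_⟩
    have : (((-i).toNat : ℤ) : ℝ) = ((-i : ℤ) : ℝ) := by rw [Int.toNat_of_nonneg (by omega)]
    rw [Int.cast_natCast, Int.cast_neg] at this
    simp only [this, Nat.cast_zero, zero_sub, neg_neg]

theorem abs_fin_sub_lt {m : ℕ} (b c : Fin m) : |((b : ℕ) : ℤ) - ((c : ℕ) : ℤ)| < m := by
  rw [abs_lt]
  omega

theorem eq_inv_mulVec_iff {p q : ℤ} (hp : p ≠ 0) (hq : q ≠ 0) (a : ℝ) (v w : Fin 2 → ℝ) :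
    v = (lowerTriangular p q a)⁻¹ *ᵥ w ↔ p * v 0 = w 0 ∧ q * v 1 = a * v 0 + w 1 := by
  have h1 : v = (lowerTriangular p q a)⁻¹ *ᵥ w ↔ lowerTriangular p q a *ᵥ v = w := by
    constructor
    · rintro rfl
      rw [Matrix.mulVec_mulVec, mul_inv_lowerTriangular hp hq, Matrix.one_mulVec]
    · rintro rfl
      rw [Matrix.mulVec_mulVec, inv_mul_lowerTriangular hp hq, Matrix.one_mulVec]
  rw [h1, funext_iff, Fin.forall_fin_two]
  simp only [lowerTriangular, Matrix.mulVec, dotProduct, Fin.sum_univ_two, Matrix.of_apply,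
    Matrix.cons_val_zero, Matrix.cons_val_one]
  constructor <;> rintro ⟨h, h'⟩ <;> constructor <;> linarith

/-- First-level pieces meet iff the difference of their digits lies in `T - T`. -/
theorem exists_radixPoint_prepend_eq_iff {p q : ℤ} (hp : 2 ≤ |p|) (hq : 2 ≤ |q|) (a : ℝ) {m n : ℕ}
    (d d' : Fin m × Fin n) :
    (∃ ω ω', radixPoint p q a (prepend d ω) = radixPoint p q a (prepend d' ω')) ↔
      IsOverlap p q a m n ((d.1 : ℕ) - (d'.1 : ℕ)) ((d.2 : ℕ) - (d'.2 : ℕ)) := by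
  have hp0 := ne_zero_of_two_le_abs hp
  have hq0 := ne_zero_of_two_le_abs hq
  obtain ⟨C, hC⟩ := exists_norm_radixPoint_le hp hq a m n
  have hhead : ∀ ω : ℕ → Fin m × Fin n, ∀ k, radixPoint p q a (fun l => ω (k + l)) =
      (lowerTriangular p q a)⁻¹ *ᵥ
        (digit (ω k) + radixPoint p q a (fun l => ω (k + 1 + l))) := by
    intro ω k
    rw [← radixPoint_prepend hp hq]
    congr 1
    funext l
    cases l with
    | zero => rfl
    | succ l => simp only [prepend]; congr 1; omega
  constructor
  · rintro ⟨ω, ω', h⟩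
    rw [radixPoint_prepend hp hq, radixPoint_prepend hp hq] at h
    have h' := congrArg (lowerTriangular p q a *ᵥ ·) h
    simp only [Matrix.mulVec_mulVec, mul_inv_lowerTriangular hp0 hq0, Matrix.one_mulVec] at h'
    let t : ℕ → Fin 2 → ℝ := fun k =>
      radixPoint p q a (fun l => ω' (k + l)) - radixPoint p q a (fun l => ω (k + l))
    have ht0 : t 0 = digit d - digit d' := by
      simp only [t, zero_add]
      rw [sub_eq_sub_iff_add_eq_add, add_comm, h']
    have ht : ∀ k, t k = (lowerTriangular p q a)⁻¹ *ᵥ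
        (digit (ω' k) - digit (ω k) + t (k + 1)) := by
      intro k
      simp only [t]
      rw [hhead ω' k, hhead ω k, ← Matrix.mulVec_sub]
      congr 1
      abel
    have hb : ∀ k, ‖t k‖ ≤ C + C := fun k =>
      (norm_sub_le _ _).trans (add_le_add (hC _) (hC _))
    refine ⟨fun k => t k 0, fun k => t k 1, ?_, ?_, ⟨C + C, fun k =>
      ⟨(norm_le_pi_norm (t k) 0).trans (hb k), (norm_le_pi_norm (t k) 1).trans (hb k)⟩⟩,
      fun k => ⟨_, _, abs_fin_sub_lt (ω' k).1 (ω k).1, abs_fin_sub_lt (ω' k).2 (ω k).2, ?_⟩⟩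
    · simp [ht0, digit]
    · simp [ht0, digit]
    · have := (eq_inv_mulVec_iff hp0 hq0 a _ _).1 (ht k)
      simp only [digit, Pi.add_apply, Pi.sub_apply, Matrix.cons_val_zero, Matrix.cons_val_one]
        at this
      push_cast
      exact ⟨by linarith [this.1], by linarith [this.2]⟩
  · rintro ⟨x, y, hx, hy, ⟨K, hK⟩, hxy⟩
    choose i j hi hj hpx hqy using hxy
    choose b c hbc using fun k => exists_fin_sub_eq (hi k)
    choose b' c' hbc' using fun k => exists_fin_sub_eq (hj k)
    refine ⟨fun k => (c k, c' k), fun k => (b k, b' k), ?_⟩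
    set ω : ℕ → Fin m × Fin n := fun k => (c k, c' k) with hω
    set ω' : ℕ → Fin m × Fin n := fun k => (b k, b' k) with hω'
    let s : ℕ → Fin 2 → ℝ := fun k => ![x k, y k] -
      (radixPoint p q a (fun l => ω' (k + l)) - radixPoint p q a (fun l => ω (k + l)))
    have hs : ∀ k, s k = (lowerTriangular p q a)⁻¹ *ᵥ s (k + 1) := by
      intro k
      have h1 : ![x k, y k] = (lowerTriangular p q a)⁻¹ *ᵥ
          (digit (ω' k) - digit (ω k) + ![x (k + 1), y (k + 1)]) := by
        rw [eq_inv_mulVec_iff hp0 hq0]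
        simp only [digit, hω, hω', Pi.add_apply, Pi.sub_apply, Matrix.cons_val_zero,
          Matrix.cons_val_one, hbc, hbc']
        exact ⟨by linarith [hpx k], by linarith [hqy k]⟩
      simp only [s]
      rw [h1, hhead ω' k, hhead ω k, ← Matrix.mulVec_sub, ← Matrix.mulVec_sub]
      congr 1
      abel
    have hsb : ∀ k, ‖s k‖ ≤ K + (C + C) := by
      intro k
      refine (norm_sub_le _ _).trans (add_le_add ?_
        ((norm_sub_le _ _).trans (add_le_add (hC _) (hC _))))
      refine (pi_norm_le_iff_of_nonneg ((abs_nonneg _).trans (hK k).1)).2 fun l => ?_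
      fin_cases l
      exacts [(hK k).1, (hK k).2]
    have h0 := eq_zero_of_bounded_orbit hp hq a hsb hs
    simp only [s, zero_add, sub_eq_zero] at h0
    rw [radixPoint_prepend hp hq, radixPoint_prepend hp hq]
    congr 1
    have h2 : ![x 0, y 0] = digit d - digit d' := by
      ext l
      fin_cases l <;> simp [hx, hy, digit]
    rw [h2, sub_eq_sub_iff_add_eq_add] at h0
    rw [h0, add_comm]

/-- Connectedness of the self-affine set as connectedness of the overlap graph on its digits. -/
theorem isConnected_selfAffineSet_iff {p q : ℤ} (hp : 2 ≤ |p|) (hq : 2 ≤ |q|) (a : ℝ) {m n : ℕ}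
    (hm : 0 < m) (hn : 0 < n) :
    IsConnected (selfAffineSet (lowerTriangular p q a) (productDigits m n)) ↔
      ∀ h : ℕ → ℕ → Prop,
        (∀ i j i' j', i < m → j < n → i' < m → j' < n →
          IsOverlap p q a m n (i - i') (j - j') → (h i j ↔ h i' j')) →
        ∀ i j i' j', i < m → j < n → i' < m → j' < n → (h i j ↔ h i' j') := by
  have hne : (Set.range (radixPoint p q a : (ℕ → Fin m × Fin n) → Fin 2 → ℝ)).Nonempty :=
    ⟨_, fun _ => (⟨0, hm⟩, ⟨0, hn⟩), rfl⟩
  rw [selfAffineSet_eq_range hp hq, IsConnected, and_iff_right hne,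
    isPreconnected_range_coding_iff (continuous_radixPoint hp hq a m n)
      (φ := fun d x => (lowerTriangular p q a)⁻¹ *ᵥ (digit d + x)) (radixPoint_prepend hp hq a)]
  simp only [exists_radixPoint_prepend_eq_iff hp hq]
  constructor
  · intro H h hh i j i' j' hi hj hi' hj'
    exact H (fun d => h d.1 d.2)
      (fun d d' hd => hh _ _ _ _ d.1.2 d.2.2 d'.1.2 d'.2.2 hd) (⟨i, hi⟩, ⟨j, hj⟩)
      (⟨i', hi'⟩, ⟨j', hj'⟩)
  · intro H h hh d d'
    have := H (fun i j => ∃ (hi : i < m) (hj : j < n), h (⟨i, hi⟩, ⟨j, hj⟩)) (by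
      intro i j i' j' hi hj hi' hj' ho
      simpa [hi, hj, hi', hj'] using hh (⟨i, hi⟩, ⟨j, hj⟩) (⟨i', hi'⟩, ⟨j', hj'⟩) ho)
      d.1 d.2 d'.1 d'.2 d.1.2 d.2.2 d'.1.2 d'.2.2
    simpa using this

/-! ### Which digit differences give overlaps -/

theorem abs_le_div_of_expanding {z : ℕ → ℝ} {c K C : ℝ} (hc : 1 < c) (hC : ∀ k, |z k| ≤ C)
    (hz : ∀ k, c * |z k| ≤ |z (k + 1)| + K) (k : ℕ) : |z k| ≤ K / (c - 1) := by
  have hc0 : 0 < c - 1 := by linarith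
  have hK : K / (c - 1) * (c - 1) = K := div_mul_cancel₀ _ hc0.ne'
  by_contra! hlt
  -- The excess over `K / (c - 1)` is multiplied by at least `c` at each step.
  have hgrow : ∀ l, c ^ l * (|z k| - K / (c - 1)) ≤ |z (k + l)| - K / (c - 1) := by
    intro l
    induction l with
    | zero => simp
    | succ l ih =>
      have h1 := mul_le_mul_of_nonneg_left ih (by linarith : (0 : ℝ) ≤ c)
      have h2 := hz (k + l)
      rw [pow_succ', mul_assoc, ← add_assoc]
      nlinarith
  obtain ⟨l, hl⟩ := pow_unbounded_of_one_lt ((C - K / (c - 1)) / (|z k| - K / (c - 1))) hc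
  rw [div_lt_iff₀ (sub_pos.2 hlt)] at hl
  linarith [hgrow l, hC (k + l)]

/-- Necessary conditions for an overlap. The first coordinates of the orbit are integers bounded by
`(m - 1) / (|p| - 1) < 2`, hence in `{-1, 0, 1}`, which limits the shear of the second ones. -/
theorem IsOverlap.bounds {p q : ℤ} (hp : 2 ≤ |p|) (hq : 2 ≤ |q|) {a : ℝ} {m n : ℕ}
    (hm' : (m : ℤ) < 2 * |p| - 1) {u v : ℤ} (h : IsOverlap p q a m n u v) :
    |u| ≤ 1 ∧ |(q : ℝ) * v - a * u| * (|(q : ℝ)| - 1) ≤ |a| + |(q : ℝ)| * (n - 1) := by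
  obtain ⟨x, y, hx, hy, ⟨C, hC⟩, hxy⟩ := h
  have hp2 := two_le_abs_cast hp
  have hq2 := two_le_abs_cast hq
  have hint : ∀ k, ∃ w : ℤ, x k = w := by
    intro k
    induction k with
    | zero => exact ⟨u, hx⟩
    | succ k ih =>
      obtain ⟨w, hw⟩ := ih
      obtain ⟨i, j, -, -, h1, -⟩ := hxy k
      refine ⟨p * w - i, ?_⟩
      push_cast
      rw [← hw]
      linarith
  have hcast : ∀ {i : ℤ} {N : ℕ}, |i| < N → |(i : ℝ)| ≤ N - 1 := by
    intro i N h
    have : |i| + 1 ≤ N := h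
    have : ((|i| + 1 : ℤ) : ℝ) ≤ ((N : ℤ) : ℝ) := by exact_mod_cast this
    push_cast at this
    linarith
  have hx1 : ∀ k, |x k| ≤ 1 := by
    intro k
    have h1 := abs_le_div_of_expanding (z := x) (c := |(p : ℝ)|) (K := m - 1) (by linarith)
      (fun k => (hC k).1) (by
        intro k
        obtain ⟨i, j, hi, -, h1, -⟩ := hxy k
        rw [← abs_mul, h1]
        exact (abs_add_le _ _).trans (add_le_add le_rfl (hcast hi))) k
    have h2 : |x k| < 2 := by
      refine h1.trans_lt ?_
      rw [div_lt_iff₀ (by linarith)]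
      have : ((m : ℤ) : ℝ) < ((2 * |p| - 1 : ℤ) : ℝ) := by exact_mod_cast hm'
      push_cast at this
      linarith
    obtain ⟨w, hw⟩ := hint k
    rw [hw] at h2 ⊢
    have h3 : |w| < 2 := by exact_mod_cast h2
    have h4 : |w| ≤ 1 := by omega
    exact_mod_cast h4
  constructor
  · have := hx1 0
    rw [hx] at this
    exact_mod_cast this
  · have h1 := abs_le_div_of_expanding (z := y) (c := |(q : ℝ)|) (K := |a| + (n - 1))
      (by linarith) (fun k => (hC k).2) (by
        intro k
        obtain ⟨i, j, -, hj, -, h1⟩ := hxy k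
        rw [← abs_mul, h1]
        have h2 : |a * x k| ≤ |a| := by
          rw [abs_mul]
          exact mul_le_of_le_one_right (abs_nonneg a) (hx1 k)
        have h3 := abs_add_le (a * x k + y (k + 1)) j
        have h4 := abs_add_le (a * x k) (y (k + 1))
        have := hcast hj
        linarith) 1
    rw [le_div_iff₀ (by linarith)] at h1
    obtain ⟨i, j, -, hj, -, h2⟩ := hxy 0
    rw [hx, hy, zero_add] at h2
    have h3 : (q : ℝ) * v - a * u = y 1 + j := by linarith
    rw [h3]
    have h4 : |y 1 + j| ≤ |y 1| + (n - 1) := (abs_add_le _ _).trans (add_le_add le_rfl (hcast hj))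
    have h5 := mul_le_mul_of_nonneg_right h4 (by linarith : (0 : ℝ) ≤ |(q : ℝ)| - 1)
    linarith

theorem IsOverlap.neg {p q : ℤ} {a : ℝ} {m n : ℕ} {u v : ℤ} (h : IsOverlap p q a m n u v) :
    IsOverlap p q a m n (-u) (-v) := by
  obtain ⟨x, y, hx, hy, ⟨C, hC⟩, hxy⟩ := h
  refine ⟨fun k => -x k, fun k => -y k, by simp [hx], by simp [hy], ⟨C, by simpa using hC⟩,
    fun k => ?_⟩
  obtain ⟨i, j, hi, hj, h1, h2⟩ := hxy k
  refine ⟨-i, -j, by simpa using hi, by simpa using hj, ?_, ?_⟩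
  · push_cast; linarith
  · push_cast; linarith

theorem exists_int_abs_sub_le {n : ℕ} (hn : 1 ≤ n) {N x : ℝ} (hN : 1 / 2 ≤ N)
    (hx : |x| ≤ N + (n - 1)) : ∃ j : ℤ, |j| < n ∧ |x - j| ≤ N := by
  rw [abs_le] at hx
  rcases lt_or_ge (n - 1 : ℝ) x with h1 | h1
  · refine ⟨n - 1, by rw [abs_lt]; omega, ?_⟩
    push_cast
    rw [abs_le]
    constructor <;> linarith
  rcases lt_or_ge x (-(n - 1) : ℝ) with h2 | h2
  · refine ⟨-(n - 1), by rw [abs_lt]; omega, ?_⟩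
    push_cast
    rw [abs_le]
    constructor <;> linarith
  · have h3 := abs_sub_round x
    refine ⟨round x, ?_, h3.trans hN⟩
    rw [abs_le] at h3
    have h4 : (round x : ℝ) < n := by linarith
    have h5 : (-n : ℝ) < round x := by linarith
    rw [abs_lt]
    exact ⟨by exact_mod_cast h5, by exact_mod_cast h4⟩

/-- `σ` is the second coordinate of `T - T` produced by the shear alone, with no digits in the
second coordinate, along some sequence `x` in `{-1, 0, 1}` starting at `u`:
`σ = a ∑ q⁻⁽ᵏ⁺¹⁾ x_k`. The sums `S k` of the shifted sequences encode this. -/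
def IsDrift (q : ℤ) (a : ℝ) (u : ℤ) (σ : ℝ) : Prop :=
  ∃ (x : ℕ → ℤ) (S : ℕ → ℝ), x 0 = u ∧ S 0 = σ ∧ (∀ k, |x k| ≤ 1) ∧ (∃ C, ∀ k, |S k| ≤ C) ∧
    ∀ k, q * S k = a * x k + S (k + 1)

theorem IsDrift.cons {q : ℤ} {a : ℝ} {w : ℤ} {τ : ℝ} (h : IsDrift q a w τ) {u : ℤ} {σ : ℝ}
    (hu : |u| ≤ 1) (hσ : q * σ = a * u + τ) : IsDrift q a u σ := by
  obtain ⟨x, S, hx, hS, hx1, ⟨C, hC⟩, hxS⟩ := h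
  refine ⟨fun k => k.casesOn u x, fun k => k.casesOn σ S, rfl, rfl, ?_, ⟨max |σ| C, ?_⟩, ?_⟩
  · rintro (_ | k)
    exacts [hu, hx1 k]
  · rintro (_ | k)
    exacts [le_max_left _ _, (hC k).trans (le_max_right _ _)]
  · rintro (_ | k)
    · simpa [hS] using hσ
    · exact hxS k

/-- The extreme drifts come from the sequences `η sᵏ`, where `s` is the sign of `q`. -/
theorem isDrift_geometric {q : ℤ} (hq : 2 ≤ |q|) (a : ℝ) {s : ℤ} (hs : s * s = 1)
    (hqs : q = s * |q|) {η : ℤ} (hη : |η| ≤ 1) :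
    IsDrift q a η (a * η * s / (|(q : ℝ)| - 1)) := by
  have hq2 := two_le_abs_cast hq
  have hs1 : |s| = 1 := by
    rcases mul_self_eq_one_iff.1 hs with rfl | rfl <;> rfl
  have hs2 : |(s : ℝ)| = 1 := by exact_mod_cast hs1
  have hss : (s : ℝ) * s = 1 := by exact_mod_cast hs
  have hqs' : (q : ℝ) = s * |(q : ℝ)| := by exact_mod_cast hqs
  refine ⟨fun k => η * s ^ k, fun k => a * η * s ^ (k + 1) / (|(q : ℝ)| - 1), by simp, by simp,
    fun k => by simpa [abs_mul, hs1] using hη, ⟨|a * η / (|(q : ℝ)| - 1)|, fun k => ?_⟩,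
    fun k => ?_⟩
  · beta_reduce
    rw [mul_div_right_comm, abs_mul _ ((s : ℝ) ^ _), abs_pow, hs2, one_pow, mul_one]
  · have h1 : |(q : ℝ)| - 1 ≠ 0 := by linarith
    have h2 : (s : ℝ) ^ (k + 1 + 1) = s ^ k := by rw [pow_succ, pow_succ, mul_assoc, hss, mul_one]
    have h3 : (q : ℝ) * s ^ (k + 1) = |(q : ℝ)| * s ^ k := by
      nth_rewrite 1 [hqs']
      rw [mul_right_comm, ← pow_succ', h2, mul_comm]
    push_cast
    calc (q : ℝ) * (a * η * s ^ (k + 1) / (|(q : ℝ)| - 1))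
        = a * η * (q * s ^ (k + 1)) / (|(q : ℝ)| - 1) := by ring
      _ = a * (η * s ^ k) + a * η * s ^ (k + 1 + 1) / (|(q : ℝ)| - 1) := by
        rw [h3, h2]
        field_simp
        ring

/-- Digits in the second coordinate reach every height within `(n - 1) / (|q| - 1)` of a drift:
`2 n - 1 ≥ |q|` makes expansions in base `q` with digits `|j| ≤ n - 1` fill an interval. -/
theorem IsDrift.isOverlap {p q : ℤ} (hq : 2 ≤ |q|) {a : ℝ} {m n : ℕ} (hm : |p| + 1 < (m : ℤ))
    (hn : (|(q : ℝ)| + 1) / 2 ≤ (n : ℝ)) {u : ℤ} {σ : ℝ} (h : IsDrift q a u σ) {v : ℤ}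
    (hv : |v * (|(q : ℝ)| - 1) - σ * (|(q : ℝ)| - 1)| ≤ n - 1) : IsOverlap p q a m n u v := by
  obtain ⟨x, S, hx, hS, hx1, ⟨C, hC⟩, hxS⟩ := h
  have hq2 := two_le_abs_cast hq
  have hq1 : 0 < |(q : ℝ)| - 1 := by linarith
  have hn1 : 1 ≤ n := by
    have : (1 : ℝ) ≤ n := by linarith
    exact_mod_cast this
  set N : ℝ := (n - 1) / (|(q : ℝ)| - 1) with hN
  have hNq : N * (|(q : ℝ)| - 1) = n - 1 := div_mul_cancel₀ _ hq1.ne'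
  have hN2 : 1 / 2 ≤ N := by
    rw [hN, le_div_iff₀ hq1]
    linarith
  have hstep : ∀ w : {w : ℝ // |w| ≤ N}, ∃ (w' : {w : ℝ // |w| ≤ N}) (j : ℤ),
      |j| < n ∧ q * w.1 = w'.1 + j := by
    rintro ⟨w, hw⟩
    obtain ⟨j, hj, hj'⟩ := exists_int_abs_sub_le (x := q * w) hn1 hN2 (by
      rw [abs_mul]
      nlinarith [mul_le_mul_of_nonneg_left hw (abs_nonneg (q : ℝ))])
    exact ⟨⟨_, hj'⟩, j, hj, by simp⟩
  choose g J hJ hg using hstep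
  have hz0 : |v - S 0| ≤ N := by
    rw [← sub_mul, abs_mul, abs_of_pos hq1] at hv
    rwa [hN, le_div_iff₀ hq1, hS]
  let z : ℕ → {w : ℝ // |w| ≤ N} := fun k => g^[k] ⟨v - S 0, hz0⟩
  refine ⟨fun k => x k, fun k => z k + S k, by simp [hx], by simp [z], ⟨max 1 (N + C), fun k =>
    ⟨?_, ?_⟩⟩, fun k => ⟨p * x k - x (k + 1), J (z k), ?_, hJ _, by push_cast; ring, ?_⟩⟩
  · exact le_max_of_le_left (show |((x k : ℤ) : ℝ)| ≤ 1 by exact_mod_cast hx1 k)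
  · exact le_max_of_le_right ((abs_add_le _ _).trans (add_le_add (z k).2 (hC k)))
  · have h1 := abs_sub (p * x k) (x (k + 1))
    rw [abs_mul] at h1
    nlinarith [hx1 k, hx1 (k + 1), abs_nonneg p]
  · have h1 := hg (z k)
    have h2 : z (k + 1) = g (z k) := Function.iterate_succ_apply' g k _
    beta_reduce
    rw [h2]
    linarith [hxS k]

/-! ### Connectedness of the overlap graph -/

/-- Vertical edges `(0, 1)` and one kind of edge `(1, v)` connect the overlap graph. -/
theorem isConnected_of_vertical_overlap {p q : ℤ} (hp : 2 ≤ |p|) (hq : 2 ≤ |q|) (a : ℝ) {m n : ℕ}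
    (hm : 0 < m) (hn : 0 < n) (h01 : IsOverlap p q a m n 0 1) {v : ℤ} (hv : |v| < n)
    (h1v : IsOverlap p q a m n 1 v) :
    IsConnected (selfAffineSet (lowerTriangular p q a) (productDigits m n)) := by
  rw [isConnected_selfAffineSet_iff hp hq a hm hn]
  intro h hh
  have hvert : ∀ i < m, ∀ j < n, (h i j ↔ h i 0) := by
    intro i hi j
    induction j with
    | zero => simp
    | succ j ih =>
      intro hj
      rw [← ih (by omega)]
      refine hh _ _ _ _ hi hj hi (by omega) ?_
      simpa using h01
  have hhor : ∀ i < m, (h i 0 ↔ h 0 0) := by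
    intro i
    induction i with
    | zero => simp
    | succ i ih =>
      intro hi
      rw [← ih (by omega)]
      rw [abs_lt] at hv
      obtain ⟨j, j', hj, hj', hjv⟩ : ∃ j j' : ℕ, j < n ∧ j' < n ∧ (j : ℤ) - j' = v := by
        rcases le_total 0 v with h0 | h0
        · exact ⟨v.toNat, 0, by omega, by omega, by omega⟩
        · exact ⟨0, (-v).toNat, by omega, by omega, by omega⟩
      rw [← hvert (i + 1) hi j hj, ← hvert i (by omega) j' hj']
      refine hh _ _ _ _ hi hj (by omega) hj' ?_
      rw [hjv]
      simpa using h1v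
  intro i j i' j' hi hj hi' hj'
  rw [hvert i hi j hj, hhor i hi, hvert i' hi' j' hj', hhor i' hi']

/-- Without vertical edges, horizontal edges `(1, 0)` and diagonal edges `(t, 1)` still connect the
overlap graph: a vertical step is a diagonal step followed by a horizontal one. -/
theorem isConnected_of_diagonal_overlap {p q : ℤ} (hp : 2 ≤ |p|) (hq : 2 ≤ |q|) (a : ℝ) {m n : ℕ}
    (hm : 1 < m) (hn : 0 < n) (h10 : IsOverlap p q a m n 1 0) {t : ℤ} (ht : t * t = 1)
    (ht1 : IsOverlap p q a m n t 1) :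
    IsConnected (selfAffineSet (lowerTriangular p q a) (productDigits m n)) := by
  rw [isConnected_selfAffineSet_iff hp hq a (by omega) hn]
  intro h hh
  have hhor : ∀ j < n, ∀ i < m, (h i j ↔ h 0 j) := by
    intro j hj i
    induction i with
    | zero => simp
    | succ i ih =>
      intro hi
      rw [← ih (by omega)]
      refine hh _ _ _ _ hi hj (by omega) hj ?_
      simpa using h10
  have hvert : ∀ j < n, (h 0 j ↔ h 0 0) := by
    intro j
    induction j with
    | zero => simp
    | succ j ih =>
      intro hj
      rw [← ih (by omega)]
      rcases mul_self_eq_one_iff.1 ht with rfl | rfl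
      · rw [← hhor (j + 1) hj 1 hm]
        refine hh _ _ _ _ hm hj (by omega) (by omega) ?_
        simpa using ht1
      · rw [← hhor j (by omega) 1 hm]
        refine hh _ _ _ _ (by omega) hj hm (by omega) ?_
        simpa using ht1
  intro i j i' j' hi hj hi' hj'
  rw [hhor j hj i hi, hvert j hj, hhor j' hj' i' hi', hvert j' hj']

/-- Sufficiency, in terms of `Q = |q|` and `b = |a| / Q`. -/
theorem isConnected_of_bounds {p q t : ℤ} {a b : ℝ} {m n : ℕ} (hp : 2 ≤ |p|) (hq : 2 ≤ |q|)
    (hm : |p| + 1 < (m : ℤ)) (hn : (|(q : ℝ)| + 1) / 2 ≤ (n : ℝ)) (ht : t * t = 1)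
    (hb : 0 ≤ b) (ha : a = t * q * b)
    (h : (|(q : ℝ)| - n ≤ b ∧ b * (|(q : ℝ)| - 2) ≤ |(q : ℝ)| * (n - 1)) ∨
      (|(q : ℝ)| - n ≤ b * |(q : ℝ)| ∧ b * (|(q : ℝ)| - 2) ≤ n - 1)) :
    IsConnected (selfAffineSet (lowerTriangular p q a) (productDigits m n)) := by
  have hq2 := two_le_abs_cast hq
  obtain ⟨s, hs, hqs⟩ : ∃ s : ℤ, s * s = 1 ∧ q = s * |q| := by
    rcases le_total 0 q with h0 | h0
    · exact ⟨1, rfl, by rw [abs_of_nonneg h0, one_mul]⟩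
    · exact ⟨-1, rfl, by rw [abs_of_nonpos h0]; ring⟩
  have hqs' : (q : ℝ) = s * |(q : ℝ)| := by exact_mod_cast hqs
  have hss : (s : ℝ) * s = 1 := by exact_mod_cast hs
  have htt : (t : ℝ) * t = 1 := by exact_mod_cast ht
  have ht1 : |t| ≤ 1 := by rcases mul_self_eq_one_iff.1 ht with rfl | rfl <;> simp
  have hs1 : |s| ≤ 1 := by rcases mul_self_eq_one_iff.1 hs with rfl | rfl <;> simp
  set Q := |(q : ℝ)| with hQ
  have hQ1 : Q - 1 ≠ 0 := by linarith
  have hQ0 : Q ≠ 0 := by linarith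
  -- The four drifts used: `b ± b / (Q - 1)` over `t`, `b / (Q - 1)` over `0`, and a smaller one over `0`.
  have hbase : ∀ {ε : ℤ}, |ε| ≤ 1 → IsDrift q a (t * ε) (Q * b * ε / (Q - 1)) := by
    intro ε hε
    have h1 := isDrift_geometric hq a hs hqs (η := t * ε)
      (by rw [abs_mul]; exact mul_le_one₀ ht1 (abs_nonneg _) hε)
    convert h1 using 2
    rw [ha]
    push_cast
    calc Q * b * ε = (t * t) * (s * s) * (Q * b * ε) := by rw [htt, hss]; ring
      _ = t * (s * Q) * b * (t * ε) * s := by ring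
      _ = _ := by rw [← hqs']
  have hlow : IsDrift q a t (b * (Q - 2) / (Q - 1)) := by
    refine (hbase (ε := -s) (by simpa using hs1)).cons ht1 ?_
    rw [ha, hqs']
    push_cast
    field_simp
    linear_combination (-(s * b * (Q - 1))) * htt
  have hhigh : IsDrift q a t (b * Q / (Q - 1)) := by
    refine (hbase (ε := s) hs1).cons ht1 ?_
    rw [ha, hqs']
    field_simp
    linear_combination (-(s * b * (Q - 1))) * htt
  have hzero : IsDrift q a 0 (b / (Q - 1)) := by
    refine (hbase (ε := s) hs1).cons (by simp) ?_
    rw [hqs']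
    push_cast
    field_simp
    ring
  have hzero' : IsDrift q a 0 (s * (b * (Q - 2) / Q) / (Q - 1)) := by
    refine hlow.cons (by simp) ?_
    rw [hqs']
    push_cast
    field_simp
    linear_combination (b * (Q - 2)) * hss
  have hn1 : 1 ≤ n := by
    have : (1 : ℝ) ≤ n := by linarith
    exact_mod_cast this
  have hm2 : 1 < m := by omega
  have O1 : ∀ v : ℤ, |v * (Q - 1) - b * (Q - 2)| ≤ n - 1 → IsOverlap p q a m n t v :=
    fun v hv => hlow.isOverlap hq hm hn (by rwa [← hQ, div_mul_cancel₀ _ hQ1])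
  have O2 : ∀ v : ℤ, |v * (Q - 1) - b * Q| ≤ n - 1 → IsOverlap p q a m n t v :=
    fun v hv => hhigh.isOverlap hq hm hn (by rwa [← hQ, div_mul_cancel₀ _ hQ1])
  have O3 : ∀ v : ℤ, |v * (Q - 1) - b| ≤ n - 1 → IsOverlap p q a m n 0 v :=
    fun v hv => hzero.isOverlap hq hm hn (by rwa [← hQ, div_mul_cancel₀ _ hQ1])
  have O4 : |(Q - 1) - b * (Q - 2) / Q| ≤ n - 1 → IsOverlap p q a m n 0 1 := by
    intro hv
    have h1 : IsOverlap p q a m n 0 s := hzero'.isOverlap hq hm hn (by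
      rw [← hQ, div_mul_cancel₀ _ hQ1, ← mul_sub, abs_mul]
      have h2 : |(s : ℝ)| ≤ 1 := by exact_mod_cast hs1
      exact (mul_le_of_le_one_left (abs_nonneg _) h2).trans hv)
    rcases mul_self_eq_one_iff.1 hs with rfl | rfl
    · exact h1
    · simpa using h1.neg
  have O5 : Q ≤ n → IsOverlap p q a m n 0 1 := by
    intro hv
    have h0 : IsDrift q a 0 0 := ⟨fun _ => 0, fun _ => 0, rfl, rfl, by simp, ⟨0, by simp⟩, by simp⟩
    refine h0.isOverlap hq hm hn ?_
    rw [← hQ, abs_le]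
    push_cast
    constructor <;> linarith
  have hunit : ∀ v : ℤ, IsOverlap p q a m n t v → ∃ v' : ℤ, |v'| = |v| ∧
      IsOverlap p q a m n 1 v' := by
    intro v hv
    rcases mul_self_eq_one_iff.1 ht with rfl | rfl
    · exact ⟨v, rfl, hv⟩
    · exact ⟨-v, abs_neg v, by simpa using hv.neg⟩
  have hfirst : b * (Q - 2) ≤ Q * (n - 1) → IsOverlap p q a m n 0 1 →
      IsConnected (selfAffineSet (lowerTriangular p q a) (productDigits m n)) := by
    intro h1 h01
    obtain ⟨v, hv, hv'⟩ := exists_int_abs_sub_le hn1 (N := (n - 1) / (Q - 1))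
      (x := b * (Q - 2) / (Q - 1))
      (by rw [le_div_iff₀ (by linarith)]; linarith) (by
        rw [abs_of_nonneg (div_nonneg (mul_nonneg hb (by linarith)) (by linarith)),
          div_le_iff₀ (by linarith), add_mul, div_mul_cancel₀ _ hQ1]
        linarith)
    have h2 : IsOverlap p q a m n t v := O1 v (by
      rw [le_div_iff₀ (by linarith), ← abs_of_pos (show 0 < Q - 1 by linarith), ← abs_mul,
        abs_of_pos (show 0 < Q - 1 by linarith), sub_mul, div_mul_cancel₀ _ hQ1,
        abs_sub_comm] at hv'
      exact hv')
    obtain ⟨v', hvv', hv1⟩ := hunit v h2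
    exact isConnected_of_vertical_overlap hp hq a (by omega) hn1 h01 (hvv' ▸ hv) hv1
  have hQb : 0 ≤ b * (Q - 2) := mul_nonneg hb (by linarith)
  have hnR : (1 : ℝ) ≤ n := by exact_mod_cast hn1
  rcases le_or_gt Q n with hQn | hQn
  · refine hfirst ?_ (O5 hQn)
    rcases h with h | h
    · exact h.2
    · nlinarith [h.2]
  · have hQ3 : 3 ≤ Q := by
      have h1 : (2 : ℝ) < Q := by
        by_contra! h2
        have h3 : (1 : ℝ) < n := by linarith
        have h4 : 2 ≤ n := by exact_mod_cast h3
        have h5 : (2 : ℝ) ≤ n := by exact_mod_cast h4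
        linarith
      have h2 : 2 < |q| := by
        rw [hQ] at h1
        exact_mod_cast h1
      have h3 : 3 ≤ |q| := by omega
      rw [hQ]
      exact_mod_cast h3
    rcases h with h | h
    · refine hfirst h.2 ?_
      rcases le_or_gt b (Q - 1 + (n - 1)) with h1 | h1
      · refine O3 1 ?_
        rw [abs_le]
        push_cast
        constructor <;> linarith [h.1]
      · refine O4 ?_
        have h2 : b * (Q - 2) / Q ≤ n - 1 := by
          rw [div_le_iff₀ (by linarith)]
          linarith [h.2]
        -- `(Q - 2) / Q ≥ 1 / 3`, while the target interval has end points of ratio at least `3`.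
        have h3 : b / 3 ≤ b * (Q - 2) / Q := by
          rw [le_div_iff₀ (by linarith)]
          nlinarith
        rw [abs_le]
        constructor <;> linarith
    · have h10 : IsOverlap p q a m n t 0 := O1 0 (by
        rw [abs_le]
        push_cast
        constructor <;> linarith [h.2])
      have h11 : IsOverlap p q a m n t 1 := by
        rcases le_or_gt (b * Q) (Q - 1 + (n - 1)) with h1 | h1
        · refine O2 1 ?_
          rw [abs_le]
          push_cast
          constructor <;> linarith [h.1]
        · refine O1 1 ?_
          have h3 : b * Q ≤ 3 * (b * (Q - 2)) := by nlinarith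
          rw [abs_le]
          push_cast
          constructor <;> linarith [h.2]
      obtain ⟨v', hv', h1v⟩ := hunit 0 h10
      rw [abs_zero, abs_eq_zero] at hv'
      rw [hv'] at h1v
      exact isConnected_of_diagonal_overlap hp hq a hm2 hn1 h1v ht h11

/-- Necessity, in terms of `Q = |q|` and `b = |a| / Q`. -/
theorem bounds_of_isConnected {p q t : ℤ} {a b : ℝ} {m n : ℕ} (hp : 2 ≤ |p|) (hq : 3 ≤ |q|)
    (hm : |p| + 1 < (m : ℤ)) (hm' : (m : ℤ) < 2 * |p| - 1)
    (hn : (|(q : ℝ)| + 1) / 2 ≤ (n : ℝ)) (ht : t * t = 1) (hb : 0 ≤ b) (ha : a = t * q * b)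
    (h : IsConnected (selfAffineSet (lowerTriangular p q a) (productDigits m n))) :
    (|(q : ℝ)| - n ≤ b ∧ b * (|(q : ℝ)| - 2) ≤ |(q : ℝ)| * (n - 1)) ∨
      (|(q : ℝ)| - n ≤ b * |(q : ℝ)| ∧ b * (|(q : ℝ)| - 2) ≤ n - 1) := by
  have hq2 : 2 ≤ |q| := by omega
  have htt : (t : ℝ) * t = 1 := by exact_mod_cast ht
  have ht1 : |(t : ℝ)| = 1 := by rcases mul_self_eq_one_iff.1 ht with rfl | rfl <;> simp
  have hQ3 : 3 ≤ |(q : ℝ)| := by exact_mod_cast hq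
  have hbound : ∀ {u v : ℤ}, IsOverlap p q a m n u v → |u| ≤ 1 ∧
      |(v : ℝ) - t * b * u| * (|(q : ℝ)| - 1) ≤ b + (n - 1) := by
    intro u v ho
    obtain ⟨h1, h2⟩ := ho.bounds hp hq2 hm'
    refine ⟨h1, ?_⟩
    have h3 : (q : ℝ) * v - a * u = q * (v - t * b * u) := by rw [ha]; ring
    have h4 : |a| = |(q : ℝ)| * b := by rw [ha, abs_mul, abs_mul, ht1, abs_of_nonneg hb, one_mul]
    rw [h3, h4, abs_mul, mul_assoc, ← mul_add] at h2
    exact le_of_mul_le_mul_left h2 (by linarith)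
  set Q := |(q : ℝ)| with hQ
  have hn2 : 2 ≤ n := by
    have : (2 : ℝ) ≤ n := by linarith
    exact_mod_cast this
  have hm2 : 2 ≤ m := by omega
  rw [isConnected_selfAffineSet_iff hp hq2 a (by omega) (by omega)] at h
  by_contra! hcon
  obtain ⟨hcon1, hcon2⟩ := hcon
  -- Otherwise no two pieces in different columns meet.
  have hhor : b * (Q - 2) ≤ Q * (n - 1) := by
    by_contra! hlt
    have := h (fun i _ => i = 0) (by
      intro i j i' j' hi hj hi' hj' ho
      obtain ⟨h1, h2⟩ := hbound ho
      suffices i = i' by rw [this]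
      by_contra hne
      have hu : |((i : ℤ) - i' : ℤ)| = 1 := le_antisymm h1 (Int.one_le_abs (by omega))
      have hu' : |(((i : ℤ) - i' : ℤ) : ℝ)| = 1 := by exact_mod_cast hu
      have hv : |((j : ℤ) - j' : ℤ)| ≤ n - 1 := by rw [abs_le]; omega
      have hv' : |(((j : ℤ) - j' : ℤ) : ℝ)| ≤ n - 1 := by exact_mod_cast hv
      have h3 := abs_sub_abs_le_abs_sub (t * b * (((i : ℤ) - i' : ℤ) : ℝ)) (((j : ℤ) - j' : ℤ) : ℝ)
      rw [abs_mul, abs_mul, ht1, hu', abs_of_nonneg hb, abs_sub_comm] at h3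
      nlinarith) 0 0 1 0 (by omega) (by omega) (by omega) (by omega)
    simp at this
  have hvert : b < Q - n := by
    by_contra! hle
    exact absurd (hcon1 hle) (not_lt.2 hhor)
  -- There are no vertical edges.
  have hu : ∀ {i j i' j' : ℕ}, IsOverlap p q a m n (i - i') (j - j') → i = i' → j = j' := by
    rintro i j i' j' ho rfl
    obtain ⟨-, h2⟩ := hbound ho
    by_contra hne
    have hv : 1 ≤ |((j : ℤ) - j' : ℤ)| := Int.one_le_abs (by omega)
    have hv' : (1 : ℝ) ≤ |(((j : ℤ) - j' : ℤ) : ℝ)| := by exact_mod_cast hv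
    simp only [sub_self, Int.cast_zero, mul_zero, sub_zero] at h2
    nlinarith
  rcases lt_or_ge (b * Q) (Q - n) with hlt | hge
  · -- All edges are horizontal, so the rows are not connected to each other.
    have := h (fun _ j => j = 0) (by
      intro i j i' j' hi hj hi' hj' ho
      obtain ⟨h1, h2⟩ := hbound ho
      suffices j = j' by rw [this]
      by_contra hne
      have hv : 1 ≤ |((j : ℤ) - j' : ℤ)| := Int.one_le_abs (by omega)
      have hv' : (1 : ℝ) ≤ |(((j : ℤ) - j' : ℤ) : ℝ)| := by exact_mod_cast hv
      have hu' : |(((i : ℤ) - i' : ℤ) : ℝ)| ≤ 1 := by exact_mod_cast h1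
      have h3 := abs_sub_abs_le_abs_sub (((j : ℤ) - j' : ℤ) : ℝ) (t * b * (((i : ℤ) - i' : ℤ) : ℝ))
      rw [abs_mul, abs_mul, ht1, abs_of_nonneg hb] at h3
      have h4 := mul_le_of_le_one_right hb hu'
      have h5 : (1 - b) * (Q - 1) ≤ |(((j : ℤ) - j' : ℤ) : ℝ) - t * b * (((i : ℤ) - i' : ℤ) : ℝ)| *
          (Q - 1) := mul_le_mul_of_nonneg_right (by linarith) (by linarith)
      have h6 := h5.trans h2
      linarith) 0 0 0 1 (by omega) (by omega) (by omega) (by omega)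
    simp at this
  · -- All edges `(t, v)` have `v ≥ 1`, so a corner is isolated.
    have hlt := hcon2 hge
    have hdiag : ∀ {i j i' j' : ℕ}, IsOverlap p q a m n (i - i') (j - j') → i ≠ i' →
        1 ≤ t * (i - i') * (j - j') := by
      intro i j i' j' ho hne
      obtain ⟨h1, h2⟩ := hbound ho
      have hu1 : |((i : ℤ) - i' : ℤ)| = 1 := le_antisymm h1 (Int.one_le_abs (by omega))
      have htu : (t * (i - i')) * (t * (i - i')) = 1 := by
        rw [mul_mul_mul_comm, ht, one_mul, ← abs_mul_abs_self, hu1, one_mul]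
      generalize hw : t * ((i : ℤ) - i') = w at htu ⊢
      generalize (j : ℤ) - j' = v at h2 ⊢
      have h3 : (t : ℝ) * b * ((i - i' : ℤ) : ℝ) = b * w := by rw [← hw]; push_cast; ring
      rw [h3] at h2
      by_contra! hlt'
      have h4 : w * v ≤ 0 := by omega
      rcases mul_self_eq_one_iff.1 htu with rfl | rfl
      · have h5 : (v : ℝ) ≤ 0 := by exact_mod_cast (by omega : v ≤ 0)
        have h6 := neg_abs_le ((v : ℝ) - b * (1 : ℤ))
        push_cast at h2 h6
        nlinarith
      · have h5 : (0 : ℝ) ≤ v := by exact_mod_cast (by omega : 0 ≤ v)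
        have h6 := le_abs_self ((v : ℝ) - b * (-1 : ℤ))
        push_cast at h2 h6
        nlinarith
    obtain ⟨c, hc, hc'⟩ : ∃ c < n, ∀ i j : ℕ, j < n → ¬ 1 ≤ t * ((i : ℤ) - 0) * (j - c) := by
      rcases mul_self_eq_one_iff.1 ht with rfl | rfl
      · refine ⟨n - 1, by omega, fun i j hj => ?_⟩
        have : (i : ℤ) * (j - (n - 1 : ℕ)) ≤ 0 :=
          mul_nonpos_of_nonneg_of_nonpos (by omega) (by omega)
        rw [one_mul, sub_zero]
        omega
      · refine ⟨0, by omega, fun i j hj => ?_⟩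
        have : (0 : ℤ) ≤ i * j := by positivity
        push_cast
        linarith
    have := h (fun i j => i = 0 ∧ j = c) (by
      intro i j i' j' hi hj hi' hj' ho
      by_cases hii : i = i'
      · rw [hu ho hii, hii]
      have hd := hdiag ho hii
      refine iff_of_false ?_ ?_
      · rintro ⟨rfl, rfl⟩
        refine hc' i' j' hj' (hd.trans_eq ?_)
        push_cast
        ring
      · rintro ⟨rfl, rfl⟩
        exact hc' i j hj hd) 0 c 1 c (by omega) hc (by omega) hc
    simp at this

theorem theorem1p1 (p q : ℤ) (hp : 2 ≤ |p|) (hq : 2 ≤ |q|) (a : ℝ) (m n : ℕ)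
    (hm : |p| + 1 < (m : ℤ)) (hm' : (m : ℤ) < 2 * |p| - 1)
    (hn : (|(q : ℝ)| + 1) / 2 ≤ (n : ℝ)) :
    (|q| = 2 → IsConnected (selfAffineSet (lowerTriangular p q a) (productDigits m n))) ∧
    (3 ≤ |q| →
      (IsConnected (selfAffineSet (lowerTriangular p q a) (productDigits m n)) ↔
        ((|(q : ℝ)| * (|(q : ℝ)| - (n : ℝ)) ≤ |a| ∧
            |a| ≤ (q : ℝ) ^ 2 * ((n : ℝ) - 1) / (|(q : ℝ)| - 2)) ∨
          (|(q : ℝ)| - (n : ℝ) ≤ |a| ∧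
            |a| ≤ |(q : ℝ)| * ((n : ℝ) - 1) / (|(q : ℝ)| - 2))))) := by
  have hq0 : (q : ℝ) ≠ 0 := by exact_mod_cast ne_zero_of_two_le_abs hq
  have hQ : 0 < |(q : ℝ)| := abs_pos.2 hq0
  obtain ⟨t, ht, hat⟩ : ∃ t : ℤ, t * t = 1 ∧ a = t * q * |a / q| := by
    rcases le_total 0 (a / q) with h0 | h0
    · refine ⟨1, rfl, ?_⟩
      rw [abs_of_nonneg h0]
      push_cast
      field_simp
    · refine ⟨-1, rfl, ?_⟩
      rw [abs_of_nonpos h0]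
      push_cast
      field_simp
  have hb : |a| = |a / q| * |(q : ℝ)| := by rw [abs_div, div_mul_cancel₀ _ hQ.ne']
  have hb0 := abs_nonneg (a / q)
  constructor
  · intro h2
    have h2' : |(q : ℝ)| = 2 := by exact_mod_cast h2
    have hn2 : (2 : ℝ) ≤ n := by
      have h3 : (1 : ℝ) < n := by linarith
      have h4 : 2 ≤ n := by exact_mod_cast h3
      exact_mod_cast h4
    refine isConnected_of_bounds hp hq hm hn ht hb0 hat (Or.inl ⟨?_, ?_⟩)
    · rw [h2']
      linarith
    · rw [h2']
      linarith
  · intro h3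
    have h3' : 3 ≤ |(q : ℝ)| := by exact_mod_cast h3
    have hcond : ((|(q : ℝ)| - n ≤ |a / q| ∧
          |a / q| * (|(q : ℝ)| - 2) ≤ |(q : ℝ)| * (n - 1)) ∨
        (|(q : ℝ)| - n ≤ |a / q| * |(q : ℝ)| ∧ |a / q| * (|(q : ℝ)| - 2) ≤ n - 1)) ↔
        ((|(q : ℝ)| * (|(q : ℝ)| - (n : ℝ)) ≤ |a| ∧
            |a| ≤ (q : ℝ) ^ 2 * ((n : ℝ) - 1) / (|(q : ℝ)| - 2)) ∨
          (|(q : ℝ)| - (n : ℝ) ≤ |a| ∧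
            |a| ≤ |(q : ℝ)| * ((n : ℝ) - 1) / (|(q : ℝ)| - 2))) := by
      rw [le_div_iff₀ (by linarith), le_div_iff₀ (by linarith), hb, ← sq_abs (q : ℝ),
        mul_comm |a / q| |(q : ℝ)|, mul_le_mul_iff_right₀ hQ, mul_assoc, sq, mul_assoc,
        mul_le_mul_iff_right₀ hQ, mul_le_mul_iff_right₀ hQ]
    rw [← hcond]
    exact ⟨bounds_of_isConnected hp h3 hm hm' hn ht hb0 hat,
      isConnected_of_bounds hp hq hm hn ht hb0 hat⟩
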